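/- Let $\Bbbk$ be a field and let $B$ be a $\Bbbk$-bialgebra with comultiplication $\Delta(b)=b_1\otimes b_2$ and counit $\varepsilon$, which is finite-dimensional or, more generally, right perfect as a ring (i.e. $B$ satisfies the descending chain condition on principal left ideals). Put $B^+=\ker\varepsilon$, and let $B\oslash B=(B\otimes B)/(B\otimes B)\Delta(B^+)$, with $x\oslash y$ the class of $x\otimes y$; it is a coalgebra with $\Delta(x\oslash y)=(x_1\oslash y_2)\otimes(x_2\oslash y_1)$ and $\varepsilon(x\oslash y)=\varepsilon(x)\varepsilon(y)$. Let $i_B\colon B\to B\oslash B$, $b\mapsto b\oslash 1$. Then: 1. $\ker(i_B)$ is a bi-ideal of $B$ (a two-sided ideal and a coideal); let $q_B\colon B\to B/\ker(i_B)$ be the projection onto the quotient bialgebra. 2. $B/\ker(i_B)$ is a Hopf algebra, with antipode $S$ say, and together with $q_B$ it is the Hopf envelope (free Hopf algebra) $\mathrm{H}(B)$ of $B$: every bialgebra map $f\colon B\to L$ into a Hopf algebra $L$ factors as $f=g\circ q_B$ for a unique Hopf algebra map $g\colon B/\ker(i_B)\to L$. 3. $\mathrm{im}(i_B)=B\oslash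 B$, and there is an isomorphism of coalgebras $$B\oslash B\;\longrightarrow\; \mathrm{H}(B)=B/\ker(i_B),\qquad x\oslash y\longmapsto q_B(x)\,S(q_B(y)),$$ whose inverse is the isomorphism $B/\ker(i_B)\cong\mathrm{im}(i_B)$, $q_B(b)\mapsto b\oslash 1$, induced by $i_B$. -/

import Mathlib

open scoped TensorProduct

universe w u v v'

/-- The co-opposite coalgebra `C^cop` of a coalgebra `C`: the same vector space with the same counit
and with the comultiplication `x ↦ x₂ ⊗ x₁`. -/
def Cop (C : Type*) : Type _ := C

namespace Cop

variable {k C : Type*} [Field k] [AddCommGroup C] [Module k C]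

instance : AddCommGroup (Cop C) := inferInstanceAs (AddCommGroup C)

instance : Module k (Cop C) := inferInstanceAs (Module k C)

/-- The comultiplication `x ↦ x₂ ⊗ x₁`. -/
noncomputable def comulAux (k C : Type*) [Field k] [AddCommGroup C] [Module k C]
    [CoalgebraStruct k C] : C →ₗ[k] C ⊗[k] C :=
  (TensorProduct.comm k C C).toLinearMap ∘ₗ Coalgebra.comul

theorem comulAux_coassoc [Coalgebra k C] :
    (TensorProduct.assoc k C C C).toLinearMap ∘ₗ (comulAux k C).rTensor C ∘ₗ comulAux k C =
      (comulAux k C).lTensor C ∘ₗ comulAux k C := by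
  let τ : C ⊗[k] (C ⊗[k] C) →ₗ[k] C ⊗[k] (C ⊗[k] C) :=
    (TensorProduct.assoc k C C C).toLinearMap ∘ₗ
      (TensorProduct.comm k C (C ⊗[k] C)).toLinearMap ∘ₗ
      (TensorProduct.comm k C C).toLinearMap.lTensor C
  have h1 : (TensorProduct.assoc k C C C).toLinearMap ∘ₗ (comulAux k C).rTensor C ∘ₗ
      (TensorProduct.comm k C C).toLinearMap = τ ∘ₗ Coalgebra.comul.lTensor C := by
    ext x y
    simp [τ, comulAux]
  have h2 : (comulAux k C).lTensor C ∘ₗ (TensorProduct.comm k C C).toLinearMap =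
      τ ∘ₗ (TensorProduct.assoc k C C C).toLinearMap ∘ₗ Coalgebra.comul.rTensor C := by
    ext x y
    simp only [τ, comulAux, TensorProduct.AlgebraTensorModule.curry_apply,
      LinearMap.restrictScalars_self, TensorProduct.curry_apply, LinearMap.comp_apply,
      LinearEquiv.coe_coe, TensorProduct.comm_tmul, LinearMap.lTensor_tmul, LinearMap.rTensor_tmul]
    induction Coalgebra.comul (R := k) x using TensorProduct.induction_on with
    | zero => simp
    | tmul a b => simp
    | add a b ha hb => simp only [TensorProduct.tmul_add, TensorProduct.add_tmul, map_add, ha, hb]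
  calc _ = ((TensorProduct.assoc k C C C).toLinearMap ∘ₗ (comulAux k C).rTensor C ∘ₗ
      (TensorProduct.comm k C C).toLinearMap) ∘ₗ Coalgebra.comul := rfl
    _ = ((comulAux k C).lTensor C ∘ₗ (TensorProduct.comm k C C).toLinearMap) ∘ₗ
        Coalgebra.comul := by
      rw [h1, h2, LinearMap.comp_assoc, ← Coalgebra.coassoc]
      rfl
    _ = _ := rfl

theorem rTensor_counit_comulAux [Coalgebra k C] :
    (Coalgebra.counit (R := k) (A := C)).rTensor C ∘ₗ comulAux k C =
      TensorProduct.mk k k C 1 := by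
  have h : (Coalgebra.counit (R := k) (A := C)).rTensor C ∘ₗ
      (TensorProduct.comm k C C).toLinearMap =
      (TensorProduct.comm k C k).toLinearMap ∘ₗ Coalgebra.counit.lTensor C := by
    ext; simp
  rw [comulAux, ← LinearMap.comp_assoc, h, LinearMap.comp_assoc,
    Coalgebra.lTensor_counit_comp_comul]
  ext; simp

theorem lTensor_counit_comulAux [Coalgebra k C] :
    (Coalgebra.counit (R := k) (A := C)).lTensor C ∘ₗ comulAux k C =
      (TensorProduct.mk k C k).flip 1 := by
  have h : (Coalgebra.counit (R := k) (A := C)).lTensor C ∘ₗ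
      (TensorProduct.comm k C C).toLinearMap =
      (TensorProduct.comm k k C).toLinearMap ∘ₗ Coalgebra.counit.rTensor C := by
    ext; simp
  rw [comulAux, ← LinearMap.comp_assoc, h, LinearMap.comp_assoc,
    Coalgebra.rTensor_counit_comp_comul]
  ext; simp

noncomputable instance [Coalgebra k C] : Coalgebra k (Cop C) where
  comul := comulAux k C
  counit := (Coalgebra.counit : C →ₗ[k] k)
  coassoc := comulAux_coassoc (k := k) (C := C)
  rTensor_counit_comp_comul := rTensor_counit_comulAux (k := k) (C := C)
  lTensor_counit_comp_comul := lTensor_counit_comulAux (k := k) (C := C)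

end Cop

section Oslash

variable (k B : Type*) [Field k] [Ring B] [Bialgebra k B]

/-- The subspace `(B ⊗ B)B⁺` of `B ⊗ B`, where `B⁺ = ker ε` and `B` acts diagonally on the right,
`(x ⊗ y) · b = xb₁ ⊗ yb₂ = (x ⊗ y)Δ(b)`. -/
def augSubmodule : Submodule k (B ⊗[k] B) :=
  Submodule.span k
    {z | ∃ (t : B ⊗[k] B) (b : B), Coalgebra.counit (R := k) b = 0 ∧ z = t * Coalgebra.comul b}

variable {k B} in
theorem mul_mem_augSubmodule (s : B ⊗[k] B) {z : B ⊗[k] B} (hz : z ∈ augSubmodule k B) :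
    s * z ∈ augSubmodule k B := by
  induction hz using Submodule.span_induction with
  | mem x h =>
    obtain ⟨t, b, hb, rfl⟩ := h
    exact Submodule.subset_span ⟨s * t, b, hb, (mul_assoc _ _ _).symm⟩
  | zero => simp
  | add x y _ _ hx hy => rw [mul_add]; exact add_mem hx hy
  | smul a x _ hx => rw [mul_smul_comm]; exact Submodule.smul_mem _ _ hx

variable {k B} in
theorem mkQ_mul_comul (t : B ⊗[k] B) (b : B) :
    (augSubmodule k B).mkQ (t * Coalgebra.comul b) =
      Coalgebra.counit (R := k) b • (augSubmodule k B).mkQ t := by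
  rw [← map_smul, ← sub_eq_zero, ← map_sub, Submodule.mkQ_apply, Submodule.Quotient.mk_eq_zero]
  refine Submodule.subset_span ⟨t, b - algebraMap k B (Coalgebra.counit b), by simp, ?_⟩
  simp [mul_sub, Algebra.algebraMap_eq_smul_one]

/-- `(B ⊗ B)B⁺`, as a subspace of `B ⊗ B^cop`. -/
def augSubmoduleCop : Submodule k (B ⊗[k] Cop B) := augSubmodule k B

/-- The comultiplication of `B ⊗ B^cop`: `x ⊗ y ↦ (x₁ ⊗ y₂) ⊗ (x₂ ⊗ y₁)`. -/
noncomputable def twistedComul : B ⊗[k] B →ₗ[k] (B ⊗[k] B) ⊗[k] (B ⊗[k] B) :=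
  (TensorProduct.tensorTensorTensorComm k B B B B).toLinearMap ∘ₗ
    TensorProduct.map Coalgebra.comul (Cop.comulAux k B)

variable {k B} in
theorem twistedComul_mul (s t : B ⊗[k] B) :
    twistedComul k B (s * t) = twistedComul k B s * twistedComul k B t := by
  let F : B ⊗[k] B →ₐ[k] (B ⊗[k] B) ⊗[k] (B ⊗[k] B) :=
    (Algebra.TensorProduct.tensorTensorTensorComm k k k k B B B B).toAlgHom.comp
      (Algebra.TensorProduct.map (Bialgebra.comulAlgHom k B)
        ((Algebra.TensorProduct.comm k B B).toAlgHom.comp (Bialgebra.comulAlgHom k B)))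
  have hF : F.toLinearMap = twistedComul k B := by
    ext x y
    rfl
  rw [← hF]
  exact map_mul F s t

variable {k B} in
theorem map_comul_comul_comp_comul :
    TensorProduct.map Coalgebra.comul Coalgebra.comul ∘ₗ (Coalgebra.comul : B →ₗ[k] B ⊗[k] B) =
      (TensorProduct.assoc k B B (B ⊗[k] B)).symm.toLinearMap ∘ₗ
        ((TensorProduct.assoc k B B B).toLinearMap ∘ₗ
          Coalgebra.comul.rTensor B).lTensor B ∘ₗ
        Coalgebra.comul.lTensor B ∘ₗ Coalgebra.comul := by
  simp only [coassoc_simps]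

variable {k B} in
theorem map_mkQ_twistedComul_comul (w : (B ⊗[k] B) ⊗[k] (B ⊗[k] B)) (b : B) :
    TensorProduct.map (augSubmodule k B).mkQ (augSubmodule k B).mkQ
      (w * twistedComul k B (Coalgebra.comul b)) =
    Coalgebra.counit (R := k) b •
      TensorProduct.map (augSubmodule k B).mkQ (augSubmodule k B).mkQ w := by
  induction w using TensorProduct.induction_on with
  | zero => simp
  | add x y hx hy => simp only [add_mul, map_add, hx, hy, smul_add]
  | tmul u v =>
    let p := (augSubmodule k B).mkQ
    -- `P` is `a ⊗ (c ⊗ e) ↦ p(u(a ⊗ e)) ⊗ ε(c)p(v)`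
    let P : B ⊗[k] (B ⊗[k] B) →ₗ[k] ((B ⊗[k] B) ⧸ augSubmodule k B) ⊗[k] ((B ⊗[k] B) ⧸ augSubmodule k B) :=
      (TensorProduct.mk k _ _).flip (p v) ∘ₗ p ∘ₗ LinearMap.mulLeft k u ∘ₗ
        ((TensorProduct.lid k B).toLinearMap ∘ₗ Coalgebra.counit.rTensor B).lTensor B
    let L : (B ⊗[k] B) ⊗[k] (B ⊗[k] B) →ₗ[k] ((B ⊗[k] B) ⧸ augSubmodule k B) ⊗[k] ((B ⊗[k] B) ⧸ augSubmodule k B) :=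
      TensorProduct.map p p ∘ₗ LinearMap.mulLeft k (u ⊗ₜ[k] v) ∘ₗ
        (TensorProduct.tensorTensorTensorComm k B B B B).toLinearMap ∘ₗ
        TensorProduct.map LinearMap.id (TensorProduct.comm k B B).toLinearMap
    have key : L ∘ₗ (TensorProduct.assoc k B B (B ⊗[k] B)).symm.toLinearMap ∘ₗ
        ((TensorProduct.assoc k B B B).toLinearMap ∘ₗ
          Coalgebra.comul.rTensor B).lTensor B = P := by
      ext a c e
      have h : ∀ z : B ⊗[k] B, L ((TensorProduct.assoc k B B (B ⊗[k] B)).symm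
          (a ⊗ₜ[k] (TensorProduct.assoc k B B B) (z ⊗ₜ[k] e))) =
          p (u * (a ⊗ₜ[k] e)) ⊗ₜ[k] p (v * z) := by
        intro z
        induction z using TensorProduct.induction_on with
        | zero => simp
        | tmul x y => simp [L]
        | add x y hx hy =>
          simp only [TensorProduct.add_tmul, TensorProduct.tmul_add, map_add, mul_add, hx, hy]
      have h2 : _ = p (u * (a ⊗ₜ[k] e)) ⊗ₜ[k] (Coalgebra.counit (R := k) c • p v) :=
        (h (Coalgebra.comul c)).trans (by rw [mkQ_mul_comul])
      simpa [P] using h2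
    have e1 : TensorProduct.map p p
        ((u ⊗ₜ[k] v) * twistedComul k B (Coalgebra.comul b)) =
        (L ∘ₗ (TensorProduct.map Coalgebra.comul Coalgebra.comul ∘ₗ Coalgebra.comul)) b := by
      have : twistedComul k B = (TensorProduct.tensorTensorTensorComm k B B B B).toLinearMap ∘ₗ
        TensorProduct.map LinearMap.id (TensorProduct.comm k B B).toLinearMap ∘ₗ
          TensorProduct.map Coalgebra.comul Coalgebra.comul := by
        rw [← TensorProduct.map_comp]
        rfl
      rw [this]
      rfl
    have e2 : (L ∘ₗ (TensorProduct.map Coalgebra.comul Coalgebra.comul ∘ₗ Coalgebra.comul)) b =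
        P ((Coalgebra.comul.lTensor B) (Coalgebra.comul b)) := by
      rw [map_comul_comul_comp_comul, ← key]
      rfl
    have e3 : P ((Coalgebra.comul.lTensor B) (Coalgebra.comul b)) =
        p (u * Coalgebra.comul b) ⊗ₜ[k] p v := by
      have : ((TensorProduct.lid k B).toLinearMap ∘ₗ Coalgebra.counit.rTensor B).lTensor B ∘ₗ
          (Coalgebra.comul (R := k) (A := B)).lTensor B = LinearMap.id := by
        rw [← LinearMap.lTensor_comp, LinearMap.comp_assoc,
          Coalgebra.rTensor_counit_comp_comul]
        ext; simp
      have := LinearMap.congr_fun this (Coalgebra.comul b)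
      simp only [LinearMap.comp_apply, LinearMap.id_apply] at this
      simp only [P, LinearMap.comp_apply]
      rw [this]
      rfl
    rw [e1, e2, e3, mkQ_mul_comul]
    rfl

variable {k B} in
theorem map_mkQ_twistedComul {x : B ⊗[k] B} (hx : x ∈ augSubmodule k B) :
    TensorProduct.map (augSubmodule k B).mkQ (augSubmodule k B).mkQ (twistedComul k B x) = 0 := by
  induction hx using Submodule.span_induction with
  | mem x h =>
    obtain ⟨t, b, hb, rfl⟩ := h
    rw [twistedComul_mul, map_mkQ_twistedComul_comul, hb, zero_smul]
  | zero => simp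
  | add x y _ _ hx hy => rw [map_add, map_add, hx, hy, add_zero]
  | smul a x _ hx => rw [map_smul, map_smul, hx, smul_zero]

variable {k B} in
theorem counit_eq_zero_of_mem {x : B ⊗[k] B} (hx : x ∈ augSubmodule k B) :
    Coalgebra.counit (R := k) x = 0 := by
  have h : ∀ b : B, Coalgebra.counit (R := k) (Coalgebra.comul (R := k) b) =
      Coalgebra.counit (R := k) b := by
    intro b
    have h1 : Coalgebra.counit (R := k) (A := B ⊗[k] B) =
        Coalgebra.counit ∘ₗ (TensorProduct.lid k B).toLinearMap ∘ₗ
          Coalgebra.counit.rTensor B := by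
      ext; simp [mul_comm]
    rw [h1]
    simp
  induction hx using Submodule.span_induction with
  | mem x h' =>
    obtain ⟨t, b, hb, rfl⟩ := h'
    rw [Bialgebra.counit_mul, h, hb, mul_zero]
  | zero => simp
  | add x y _ _ hx hy => rw [map_add, hx, hy, add_zero]
  | smul a x _ hx => rw [map_smul, hx, smul_zero]

theorem augSubmoduleCop_isCoideal : (augSubmoduleCop k B).IsCoideal :=
  ⟨fun _ hx => counit_eq_zero_of_mem hx, fun _ hx => map_mkQ_twistedComul hx⟩

/-- `B ⊘ B = (B ⊗ B) / (B ⊗ B)B⁺`. -/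
def Oslash : Type _ := (B ⊗[k] B) ⧸ augSubmodule k B

namespace Oslash

noncomputable instance : AddCommGroup (Oslash k B) :=
  inferInstanceAs (AddCommGroup ((B ⊗[k] B) ⧸ augSubmodule k B))

noncomputable instance : Module k (Oslash k B) :=
  inferInstanceAs (Module k ((B ⊗[k] B) ⧸ augSubmodule k B))

/-- `B ⊘ B` is the quotient coalgebra of `B ⊗ B^cop` by the coideal `(B ⊗ B)B⁺`; so
`Δ(x ⊘ y) = (x₁ ⊘ y₂) ⊗ (x₂ ⊘ y₁)` and `ε(x ⊘ y) = ε(x)ε(y)` (see `comul_mk` and `counit_mk`). -/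
noncomputable instance : Coalgebra k (Oslash k B) :=
  haveI := augSubmoduleCop_isCoideal k B
  inferInstanceAs (Coalgebra k ((B ⊗[k] Cop B) ⧸ augSubmoduleCop k B))

variable {B} in
/-- The class `x ⊘ y` of `x ⊗ y`. -/
noncomputable def mk (x y : B) : Oslash k B := (augSubmodule k B).mkQ (x ⊗ₜ[k] y)

variable {B} in
theorem counit_mk (x y : B) : Coalgebra.counit (R := k) (mk k x y) =
    Coalgebra.counit (R := k) x * Coalgebra.counit (R := k) y := by
  rw [mul_comm]; rfl

variable {B} in
theorem comul_mk {ι κ : Type*} {x y : B} (rx : Coalgebra.Repr k x ι) (ry : Coalgebra.Repr k y κ) :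
    Coalgebra.comul (R := k) (mk k x y) = ∑ i ∈ rx.index, ∑ j ∈ ry.index,
      mk k (rx.left i) (ry.right j) ⊗ₜ[k] mk k (rx.right i) (ry.left j) := by
  have : Coalgebra.comul (R := k) (mk k x y) =
      TensorProduct.map (augSubmodule k B).mkQ (augSubmodule k B).mkQ
        (twistedComul k B (x ⊗ₜ[k] y)) := rfl
  rw [this]
  simp only [twistedComul, Cop.comulAux, LinearMap.comp_apply, TensorProduct.map_tmul, ← rx.eq,
    ← ry.eq, map_sum, TensorProduct.sum_tmul, TensorProduct.tmul_sum, LinearEquiv.coe_coe,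
    TensorProduct.comm_tmul, TensorProduct.tensorTensorTensorComm_tmul]
  rw [Finset.sum_comm]
  rfl

end Oslash

/-- The canonical map `i_B : B → B ⊘ B`, `b ↦ b ⊘ 1`. -/
noncomputable def iMap : B →ₗ[k] Oslash k B :=
  (augSubmodule k B).mkQ ∘ₗ (TensorProduct.mk k B B).flip 1

theorem iMap_apply (b : B) : iMap k B b = Oslash.mk k b 1 := rfl

theorem iMap_eq_zero_iff (b : B) : iMap k B b = 0 ↔ b ⊗ₜ[k] (1 : B) ∈ augSubmodule k B :=
  Submodule.Quotient.mk_eq_zero _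

/-- `ker(i_B)`, which is always a left ideal of `B`. -/
noncomputable def kerI : Ideal B where
  carrier := {b | iMap k B b = 0}
  add_mem' {a b} ha hb := by
    simp only [Set.mem_ofPred_eq] at ha hb ⊢
    rw [map_add, ha, hb, add_zero]
  zero_mem' := map_zero _
  smul_mem' a b hb := by
    simp only [Set.mem_ofPred_eq, iMap_eq_zero_iff] at hb ⊢
    simpa using mul_mem_augSubmodule (a ⊗ₜ[k] (1 : B)) hb

theorem kerI_restrictScalars : (kerI k B).restrictScalars k = LinearMap.ker (iMap k B) := rfl

end Oslash

/-- A ring `R` is right perfect: every descending chain `Ra₀ ⊇ Ra₁ ⊇ ⋯` of principal *left* ideals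
is stationary. (`Ideal` means left ideal.) -/
def IsRightPerfectRing (R : Type*) [Ring R] : Prop :=
  ∀ a : ℕ → R, Antitone (fun n => Ideal.span {a n}) →
    ∃ n, ∀ m, n ≤ m → Ideal.span {a m} = Ideal.span {a n}

/-- `S` is an antipode of the bialgebra `H`: a two-sided convolution inverse of the identity,
`S(x₁)x₂ = ε(x)1 = x₁S(x₂)`. -/
def IsAntipode (k : Type*) {H : Type*} [Field k] [Ring H] [Bialgebra k H] (S : H →ₗ[k] H) : Prop :=
  LinearMap.mul' k H ∘ₗ S.rTensor H ∘ₗ Coalgebra.comul =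
      Algebra.linearMap k H ∘ₗ Coalgebra.counit ∧
    LinearMap.mul' k H ∘ₗ S.lTensor H ∘ₗ Coalgebra.comul =
      Algebra.linearMap k H ∘ₗ Coalgebra.counit

/-- The bialgebra map `η : B → H` exhibits `H` as the free Hopf algebra (Hopf envelope) `H(B)`
generated by the bialgebra `B`: `H` has an antipode, and every bialgebra map from `B` to a Hopf
algebra `L` factors uniquely through `η` by a Hopf algebra map `H → L`. (A Hopf algebra map is a
bialgebra map between Hopf algebras; it preserves the antipodes automatically.) -/
def IsHopfEnvelope {k : Type u} {B : Type v} {H : Type v'} [Field k] [Ring B]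
    [Bialgebra k B] [Ring H] [Bialgebra k H] (η : B →ₐc[k] H) : Prop :=
  (∃ S : H →ₗ[k] H, IsAntipode k S) ∧
    ∀ (L : Type w) [Ring L] [HopfAlgebra k L] (f : B →ₐc[k] L), ∃! g : H →ₐc[k] L, g.comp η = f

/-!
Everything rests on one fact about a right perfect ring `R`: every square matrix `T` over `R` is
left `π`-regular, `Tⁿ = A Tⁿ⁺¹` for some `n` and `A` (`IsRightPerfectRing.exists_pow_eq_mul_pow_succ`).
Equivalently, the ranges of the powers of an endomorphism of the left module `Rⁿ` are stationary.
Modulo the radical `J` this is Fitting's lemma, since `R / J` is semisimple; it lifts to `Rⁿ`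
because a sequence of finitely generated modules with `Gᵢ₊₁ ≤ J Gᵢ` reaches zero.

By the finiteness theorem for comodules a bialgebra `B` is spanned by the entries of comatrices,
`Δ(tᵢⱼ) = ∑ tᵢₗ ⊗ tₗⱼ` and `ε(tᵢⱼ) = δᵢⱼ`; the relation of `B ⊘ B` reads
`∑ₗ x tᵢₗ ⊘ y tₗⱼ = δᵢⱼ x ⊘ y`. It produces sequences of vectors `v` over `B ⊘ B` with
`M vₚ₊₁ = vₚ`, where `M` is `T` acting on the first tensor factor or `Tᵗ` acting on the second, and
`Mⁿ = A Mⁿ⁺¹` then gives `v₁ = A v₀` (`eq_smul_of_pow_eq_mul_pow_succ`).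

* On the first factor, `v₀` is a column of the identity matrix and `v₁` is a column of `1 ⊘ T`, so
  that `1 ⊘ T = A ⊘ 1` (`exists_mk_one_comatrix_eq`) and `i_B` is surjective.
* On the second factor, `v₀` is a row of `κ ⊘ 1`, for `κ ∈ ker(i_B)`, and `v₁` is a row of `κT ⊘ 1`.
  Hence `κT ⊘ 1 = 0`: the left ideal `ker(i_B)` is two-sided (`mul_mem_kerI`).

As `i_B` is a coalgebra map, `Q = B / ker(i_B)` is a bialgebra, isomorphic to `B ⊘ B` as a
coalgebra, and `y ↦ 1 ⊘ y` becomes a map `s : B → Q` with `s(T) = q(A)`, which is a two-sided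
inverse of `q(T)`.
That `s` vanishes on `ker(i_B)` is not formal, and is once more an application of `π`-regularity,
now over `Q` (`eq_zero_of_comatrix_inverse`). So `s` descends to an antipode of `Q`. A bialgebra
map `f` to a Hopf algebra kills `ker(i_B)` because `x ⊘ y ↦ f(x)S(f(y))` is well defined.
-/

/-! ### Perfect rings -/

section PerfectRings

variable {R : Type*} [Ring R] {M : Type*} [AddCommGroup M] [Module R M]

/-- Over a right perfect ring every nonempty set of elements of a left module contains one that
generates a cyclic submodule minimal among those generated by elements of the set. -/
theorem IsRightPerfectRing.exists_minimal_span_singleton (h : IsRightPerfectRing R) {s : Set M}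
    (hs : s.Nonempty) :
    ∃ x ∈ s, ∀ y ∈ s, y ∈ Submodule.span R {x} → x ∈ Submodule.span R {y} := by
  by_contra! hc
  have H : ∀ x : s, ∃ (r : R) (y : s), (y : M) = r • (x : M) ∧
      (x : M) ∉ Submodule.span R {(y : M)} := by
    rintro ⟨x, hx⟩
    obtain ⟨y, hy, hyx, hxy⟩ := hc x hx
    obtain ⟨r, hr⟩ := Submodule.mem_span_singleton.1 hyx
    exact ⟨r, ⟨y, hy⟩, hr.symm, hxy⟩
  choose r f hf hf' using H
  obtain ⟨x₀, hx₀⟩ := hs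
  let x : ℕ → s := fun n => n.rec ⟨x₀, hx₀⟩ fun _ y => f y
  let a : ℕ → R := fun n => n.rec 1 fun n b => r (x n) * b
  have ha : ∀ n, a (n + 1) = r (x n) * a n := fun n => rfl
  have hxa : ∀ n : ℕ, (x n).1 = a n • x₀ := by
    intro n
    induction n with
    | zero => simp [x, a]
    | succ n ih => rw [ha, mul_smul, ← ih]; exact hf _
  obtain ⟨n, hn⟩ := h a (antitone_nat_of_succ_le fun n => by
    rw [Ideal.span_singleton_le_iff_mem, ha]
    exact Ideal.mul_mem_left _ _ (Ideal.mem_span_singleton_self _))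
  have h1 : a n ∈ Ideal.span {a (n + 1)} := by
    rw [hn (n + 1) n.le_succ]; exact Ideal.mem_span_singleton_self _
  obtain ⟨c, hc⟩ := Ideal.mem_span_singleton'.1 h1
  refine hf' (x n) (Submodule.mem_span_singleton.2 ⟨c, ?_⟩)
  exact (congrArg (c • ·) (hxa (n + 1))).trans (by rw [← mul_smul, hc, hxa n])

/-- A cyclic module with zero radical over a right perfect ring is semisimple: a minimal direct
summand with semisimple complement must vanish, since a simple submodule of it avoids some maximal
submodule and so splits off. -/
theorem IsRightPerfectRing.isSemisimpleModule (h : IsRightPerfectRing R) {g : M}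
    (hg : Submodule.span R {g} = ⊤) (hJ : Module.jacobson R M = ⊥) : IsSemisimpleModule R M := by
  have cyclic : ∀ N C : Submodule R M, IsCompl N C → ∃ a, N = Submodule.span R {a} := by
    intro N C hNC
    obtain ⟨a, ha, c, hc, hac⟩ := Submodule.mem_sup.1
      (show g ∈ N ⊔ C by rw [hNC.sup_eq_top]; trivial)
    refine ⟨a, le_antisymm (fun x hx => ?_) ((Submodule.span_singleton_le_iff_mem _ _).2 ha)⟩
    obtain ⟨r, rfl⟩ := Submodule.mem_span_singleton.1 (show x ∈ Submodule.span R {g} by simp [hg])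
    have h1 : r • c ∈ N := by
      have : r • c = r • g - r • a := by rw [← hac, smul_add]; abel
      rw [this]; exact N.sub_mem hx (N.smul_mem _ ha)
    have h2 : r • c = 0 := by
      have := hNC.inf_eq_bot.le ⟨h1, C.smul_mem r hc⟩
      simpa using this
    rw [← hac, smul_add, h2, add_zero]
    exact Submodule.smul_mem _ _ (Submodule.mem_span_singleton_self _)
  obtain ⟨x, ⟨C, hxC, hC⟩, hmin⟩ := h.exists_minimal_span_singleton
    (s := {x : M | ∃ C : Submodule R M, IsCompl (Submodule.span R {x}) C ∧ IsSemisimpleModule R C})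
    ⟨g, ⊥, by rw [hg]; exact isCompl_top_bot,
      (isSemisimpleModule_iff R _).2 Subsingleton.instComplementedLattice⟩
  by_cases hx : x = 0
  · have hC' : C = ⊤ := by
      have := hxC.sup_eq_top
      rwa [hx, Submodule.span_zero_singleton, bot_sup_eq] at this
    subst hC'
    exact Submodule.topEquiv.isSemisimpleModule_iff.1 hC
  exfalso
  obtain ⟨z, ⟨hzx, hz⟩, hzmin⟩ := h.exists_minimal_span_singleton
    (s := {z : M | z ∈ Submodule.span R {x} ∧ z ≠ 0})
    ⟨x, Submodule.mem_span_singleton_self _, hx⟩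
  set L := Submodule.span R {z} with hL
  have hLx : L ≤ Submodule.span R {x} := (Submodule.span_singleton_le_iff_mem _ _).2 hzx
  have hatom : IsAtom L := by
    refine ⟨by simpa [hL] using hz, fun N hN => ?_⟩
    rw [Submodule.eq_bot_iff]
    intro y hy
    by_contra hy0
    refine hN.not_ge ?_
    rw [hL, Submodule.span_singleton_le_iff_mem]
    have := hzmin y ⟨hLx (hN.le hy), hy0⟩ (hN.le hy)
    exact ((Submodule.span_singleton_le_iff_mem _ _).2 hy) this
  obtain ⟨m, hm, hzm⟩ : ∃ m : Submodule R M, IsCoatom m ∧ z ∉ m := by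
    by_contra! hcon
    have : z ∈ Module.jacobson R M := by
      rw [Module.jacobson, Submodule.mem_sInf]; exact fun m hm => hcon m hm
    rw [hJ] at this
    exact hz (by simpa using this)
  have hLm : IsCompl L m := by
    have hle : ¬ L ≤ m := fun hle => hzm (hle (Submodule.mem_span_singleton_self _))
    exact ⟨hatom.not_le_iff_disjoint.1 hle,
      codisjoint_iff.2 (hm.2 _ (right_lt_sup.2 hle))⟩
  set N := Submodule.span R {x} with hN
  have hcompl : IsCompl (m ⊓ N) (L ⊔ C) := by
    constructor
    · rw [Submodule.disjoint_def]
      rintro y ⟨hym, hyN⟩ hy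
      obtain ⟨l, hl, c, hc, rfl⟩ := Submodule.mem_sup.1 hy
      have hcN : c ∈ N := by
        have := N.sub_mem hyN (hLx hl)
        simpa using this
      have hc0 : c = 0 := by simpa using hxC.inf_eq_bot.le ⟨hcN, hc⟩
      subst hc0
      rw [add_zero] at hym ⊢
      simpa using hLm.inf_eq_bot.le ⟨hl, hym⟩
    · rw [codisjoint_iff, ← sup_assoc, sup_comm (m ⊓ N) L, ← sup_inf_assoc_of_le _ hLx,
        hLm.sup_eq_top, top_inf_eq, hxC.sup_eq_top]
  obtain ⟨a, ha⟩ := cyclic _ _ hcompl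
  have hLs : IsSemisimpleModule R L := by
    have : IsSimpleModule R L := isSimpleModule_iff_isAtom.2 hatom
    infer_instance
  have hLC : IsSemisimpleModule R (L ⊔ C : Submodule R M) :=
    IsSemisimpleModule.sup hLs hC
  have haN : a ∈ N := by
    have : a ∈ m ⊓ N := by rw [ha]; exact Submodule.mem_span_singleton_self _
    exact this.2
  have := hmin a ⟨L ⊔ C, ha ▸ hcompl, hLC⟩ haN
  rw [← ha] at this
  exact hzm (((Submodule.span_singleton_le_iff_mem _ _).2 this.1) hzx)

theorem IsRightPerfectRing.isSemisimpleModule_quotient_jacobson (h : IsRightPerfectRing R) :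
    IsSemisimpleModule R (R ⧸ Ring.jacobson R) := by
  refine h.isSemisimpleModule (g := Submodule.Quotient.mk 1) ?_
    (Module.jacobson_quotient_jacobson R R)
  rw [eq_top_iff]
  rintro x -
  obtain ⟨r, rfl⟩ := Submodule.Quotient.mk_surjective _ x
  exact Submodule.mem_span_singleton.2 ⟨r, by rw [← Submodule.Quotient.mk_smul]; simp⟩

/-- Module form of the `T`-nilpotence of the radical. -/
theorem IsRightPerfectRing.exists_eq_bot (h : IsRightPerfectRing R) (G : ℕ → Submodule R M)
    (hfg : ∀ i, (G i).FG) (hG : ∀ i, G (i + 1) ≤ Ring.jacobson R • G i) : ∃ i, G i = ⊥ := by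
  -- `𝒦` is the set of submodules in which every such sequence reaches zero; it has a maximal
  -- element `K`, and if `K ≠ ⊤`, then some `x ∉ K` has `J x ⊆ K`, so `K + R x` belongs to `𝒦`.
  let 𝒦 : Set (Submodule R M) := {K | ∀ G : ℕ → Submodule R M, (∀ i, (G i).FG) →
    (∀ i, G (i + 1) ≤ Ring.jacobson R • G i) → G 0 ≤ K → ∃ i, G i = ⊥}
  obtain ⟨K, hK⟩ : ∃ K, Maximal (· ∈ 𝒦) K := by
    have hub : ∀ c ⊆ 𝒦, IsChain (· ≤ ·) c → ∀ y ∈ c, ∃ ub ∈ 𝒦, ∀ z ∈ c, z ≤ ub := by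
      intro c hc hchain y hy
      refine ⟨sSup c, fun G hfg hG h0 => ?_, fun z hz => le_sSup hz⟩
      obtain ⟨z, hz, hle⟩ :=
        (CompleteLattice.isCompactElement_iff_le_of_directed_sSup_le _ _).1
          ((Submodule.fg_iff_compact _).1 (hfg 0)) c ⟨y, hy⟩ hchain.directedOn h0
      exact hc hz G hfg hG hle
    obtain ⟨K, -, hK⟩ := zorn_le_nonempty₀ 𝒦 hub ⊥ (fun G _ _ h0 => ⟨0, le_bot_iff.1 h0⟩)
    exact ⟨K, hK⟩
  suffices hKtop : K = ⊤ from hK.prop G hfg hG (hKtop ▸ le_top)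
  by_contra hne
  obtain ⟨x, hxK, hJx⟩ : ∃ x ∉ K, ∀ a ∈ Ring.jacobson R, a • x ∈ K := by
    obtain ⟨x₀, -, hx₀⟩ := SetLike.exists_of_lt (lt_top_iff_ne_top.2 hne)
    obtain ⟨x', hx', hmin⟩ := h.exists_minimal_span_singleton (M := M ⧸ K) (s := {y | y ≠ 0})
      ⟨Submodule.Quotient.mk x₀, by simpa [Submodule.Quotient.mk_eq_zero] using hx₀⟩
    obtain ⟨x, rfl⟩ := Submodule.Quotient.mk_surjective _ x'
    refine ⟨x, by simpa [Submodule.Quotient.mk_eq_zero] using hx', fun a ha => ?_⟩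
    by_contra hax
    have h1 := hmin (a • Submodule.Quotient.mk x) (by
      rw [Set.mem_ofPred_eq, ← Submodule.Quotient.mk_smul]
      rwa [Ne, Submodule.Quotient.mk_eq_zero])
      (Submodule.smul_mem _ _ (Submodule.mem_span_singleton_self _))
    refine hx' ?_
    have h2 := (Submodule.fg_span_singleton (R := R)
      (Submodule.Quotient.mk x : M ⧸ K)).eq_bot_of_le_jacobson_smul (by
        refine (Submodule.span_singleton_le_iff_mem _ _).2 ?_
        refine (Submodule.span_singleton_le_iff_mem _ _).2 ?_ h1
        exact Submodule.smul_mem_smul ha (Submodule.mem_span_singleton_self _))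
    simpa using h2
  have hmem : K ⊔ Submodule.span R {x} ∈ 𝒦 := by
    intro G hfg hG h0
    obtain ⟨i, hi⟩ := hK.prop (fun i => G (i + 1)) (fun i => hfg _) (fun i => hG _) (by
      refine (hG 0).trans ((smul_mono_right _ h0).trans ?_)
      rw [Submodule.smul_sup]
      refine sup_le (Submodule.smul_le_right) ?_
      rw [Submodule.smul_le]
      intro a ha n hn
      obtain ⟨r, rfl⟩ := Submodule.mem_span_singleton.1 hn
      rw [← mul_smul]
      exact hJx _ (Ideal.mul_mem_right _ _ ha))
    exact ⟨i + 1, hi⟩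
  exact hxK (hK.le_of_ge hmem le_sup_left (Submodule.mem_sup_right
    (Submodule.mem_span_singleton_self _)))

end PerfectRings

/-! ### Fitting's lemma over a perfect ring -/

section PerfectRings

variable {R : Type*} [Ring R]

theorem IsRightPerfectRing.isArtinian_quotient_jacobson_smul_top (h : IsRightPerfectRing R)
    (ι : Type*) [Finite ι] :
    IsArtinian R ((ι → R) ⧸ Ring.jacobson R • (⊤ : Submodule R (ι → R))) := by
  classical
  have := Fintype.ofFinite ι
  have := h.isSemisimpleModule_quotient_jacobson
  let f : (ι → R) →ₗ[R] (ι → R ⧸ Ring.jacobson R) := (Ring.jacobson R).mkQ.compLeft ι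
  have hf : LinearMap.ker f = Ring.jacobson R • (⊤ : Submodule R (ι → R)) := by
    apply le_antisymm
    · intro v hv
      have hv' : ∀ i, v i ∈ Ring.jacobson R := fun i =>
        (Submodule.Quotient.mk_eq_zero _).1 (congrFun hv i)
      rw [pi_eq_sum_univ v]
      exact Submodule.sum_mem _ fun i _ => Submodule.smul_mem_smul (hv' i) trivial
    · rw [Submodule.smul_le]
      intro a ha v _
      refine funext fun i => (Submodule.Quotient.mk_eq_zero _).2 ?_
      exact Ideal.mul_mem_right _ _ ha
  refine isArtinian_of_injective (Submodule.liftQ _ f hf.ge) (LinearMap.ker_eq_bot.1 ?_)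
  exact Submodule.ker_liftQ_eq_bot _ _ _ hf.le

theorem Submodule.FG.le_of_le_sup_jacobson_smul {M : Type*} [AddCommGroup M] [Module R M]
    {U N : Submodule R M} (hU : U.FG) (h : U ≤ N ⊔ Ring.jacobson R • U) : U ≤ N := by
  have h1 : U.map N.mkQ = ⊥ := (hU.map N.mkQ).eq_bot_of_le_jacobson_smul (by
    have := Submodule.map_mono (f := N.mkQ) h
    rwa [Submodule.map_sup, Submodule.mkQ_map_self, bot_sup_eq, Submodule.map_smul''] at this)
  have h2 := Submodule.map_le_iff_le_comap.1 h1.le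
  rwa [Submodule.comap_bot, Submodule.ker_mkQ] at h2

theorem Submodule.FG.exists_fg_le_sup {M : Type*} [AddCommGroup M] [Module R M]
    {U N H : Submodule R M} (hU : U.FG) (h : U ≤ N ⊔ H) :
    ∃ G ≤ H, G.FG ∧ U ≤ N ⊔ G := by
  obtain ⟨s, rfl⟩ := hU
  have hs : ∀ x : s, ∃ y ∈ H, (x : M) ∈ N ⊔ Submodule.span R {y} := by
    intro x
    obtain ⟨n, hn, y, hy, hxy⟩ := Submodule.mem_sup.1 (h (Submodule.subset_span x.2))
    exact ⟨y, hy, hxy ▸ add_mem (Submodule.mem_sup_left hn)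
      (Submodule.mem_sup_right (Submodule.mem_span_singleton_self y))⟩
  choose y hy hxy using hs
  refine ⟨Submodule.span R (Set.range y), Submodule.span_le.2 ?_,
    Submodule.fg_span (Set.finite_range y), Submodule.span_le.2 fun x hx => ?_⟩
  · rintro _ ⟨x, rfl⟩
    exact hy x
  · refine sup_le_sup_left (Submodule.span_mono ?_) N (hxy ⟨x, hx⟩)
    rintro _ rfl
    exact ⟨_, rfl⟩

/-- Fitting's lemma over a right perfect ring: the ranges of the powers of an endomorphism of a
free left module of finite rank become stationary. -/
theorem IsRightPerfectRing.exists_range_pow_le (h : IsRightPerfectRing R) {ι : Type*} [Finite ι]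
    (f : Module.End R (ι → R)) :
    ∃ n, LinearMap.range (f ^ n) ≤ LinearMap.range (f ^ (n + 1)) := by
  set J := Ring.jacobson R
  set E : Submodule R (ι → R) := ⊤ with hE
  have := h.isArtinian_quotient_jacobson_smul_top ι
  have map_J : ∀ (g : Module.End R (ι → R)) (N : Submodule R (ι → R)),
      (J • N).map g = J • N.map g := fun g N => Submodule.map_smul'' _ _ _
  have hfJ : J • E ≤ (J • E).comap f := by
    rw [← Submodule.map_le_iff_le_comap, map_J]
    exact smul_mono_right _ le_top
  let fb : Module.End R ((ι → R) ⧸ J • E) := (J • E).mapQ (J • E) f hfJ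
  have hfb : ∀ (m : ℕ) (v : ι → R), (fb ^ m) ((J • E).mkQ v) = (J • E).mkQ ((f ^ m) v) := by
    intro m v
    induction m with
    | zero => simp
    | succ m ih => rw [pow_succ', pow_succ', Module.End.mul_apply, ih]; rfl
  -- Fitting's lemma modulo the radical gives a power `g` of `f` with `E = g E + g⁻¹(J E)`
  obtain ⟨m, hm, hm1⟩ := ((LinearMap.eventually_codisjoint_ker_pow_range_pow fb).and
    (Filter.eventually_ge_atTop 1)).exists
  set g := f ^ m with hg
  have hg1 : E ≤ E.map g ⊔ (J • E).comap g := by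
    intro v _
    obtain ⟨y, hy, z, ⟨w, rfl⟩, hyz⟩ := Submodule.mem_sup.1
      (show (J • E).mkQ v ∈ LinearMap.ker (fb ^ m) ⊔ LinearMap.range (fb ^ m) by
        rw [codisjoint_iff.1 hm]; trivial)
    obtain ⟨w, rfl⟩ := (J • E).mkQ_surjective w
    rw [hfb] at hyz
    have hvw : (J • E).mkQ (v - g w) = y := by rw [map_sub, ← hyz, hg]; abel
    have h2 : g (v - g w) ∈ J • E := by
      rw [LinearMap.mem_ker, ← hvw, hfb] at hy
      exact (Submodule.Quotient.mk_eq_zero _).1 hy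
    exact Submodule.mem_sup.2 ⟨g w, ⟨w, trivial, rfl⟩, v - g w, h2, by abel⟩
  let U : ℕ → Submodule R (ι → R) := fun i => E.map (g ^ i)
  have hUfg : ∀ i, (U i).FG := fun i => Module.Finite.fg_top.map _
  have hUsucc : ∀ i, U (i + 1) ≤ U i := by
    rintro i _ ⟨v, -, rfl⟩
    exact ⟨g v, trivial, by rw [pow_succ, Module.End.mul_apply]⟩
  have hstep : ∀ (i : ℕ) (G : Submodule R (ι → R)), G ≤ U i → U i ≤ U (i + 1) ⊔ G →
      ∃ G' : Submodule R (ι → R), G'.FG ∧ G' ≤ U (i + 1) ∧ U (i + 1) ≤ U (i + 2) ⊔ G' ∧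
        G' ≤ J • G := by
    intro i G hG hUG
    have h1 : U (i + 1) ≤ U (i + 2) ⊔ (J • G ⊓ U (i + 1)) ⊔ J • U (i + 1) := by
      have h2 : U (i + 1) ≤ U (i + 2) ⊔ (J • U i ⊓ U (i + 1)) := by
        rintro _ ⟨v, -, rfl⟩
        obtain ⟨_, ⟨w, -, rfl⟩, z, hz, rfl⟩ := Submodule.mem_sup.1 (hg1 (x := v) trivial)
        rw [map_add]
        refine add_mem (Submodule.mem_sup_left ⟨w, trivial, ?_⟩)
          (Submodule.mem_sup_right ⟨?_, z, trivial, rfl⟩)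
        · rw [pow_succ _ (i + 1), Module.End.mul_apply]
        · rw [pow_succ, Module.End.mul_apply]
          have : (J • E).map (g ^ i) = J • U i := map_J _ _
          rw [SetLike.mem_coe, ← this]
          exact Submodule.mem_map_of_mem hz
      have h3 : J • U i ⊓ U (i + 1) ≤ (J • G ⊓ U (i + 1)) ⊔ J • U (i + 1) := by
        have h4 : J • U i ≤ J • U (i + 1) ⊔ J • G := by
          rw [← Submodule.smul_sup]; exact smul_mono_right _ hUG
        rw [sup_comm, ← sup_inf_assoc_of_le _ Submodule.smul_le_right]
        exact inf_le_inf_right _ h4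
      rw [sup_assoc]
      exact h2.trans (sup_le_sup_left h3 _)
    obtain ⟨G', hG', hfg, hle⟩ := (hUfg (i + 1)).exists_fg_le_sup
      ((hUfg (i + 1)).le_of_le_sup_jacobson_smul h1)
    exact ⟨G', hfg, hG'.trans inf_le_right, hle, hG'.trans inf_le_left⟩
  -- by Nakayama's lemma `Uᵢ = Uᵢ₊₁ + Gᵢ` with `Gᵢ₊₁ ≤ J Gᵢ`, so `Uᵢ = Uᵢ₊₁` once `Gᵢ` is zero
  choose! next hnext using hstep
  let G : ℕ → Submodule R (ι → R) := fun i => i.rec (U 0) next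
  have hG : ∀ i, (G i).FG ∧ G i ≤ U i ∧ U i ≤ U (i + 1) ⊔ G i := by
    intro i
    induction i with
    | zero => exact ⟨hUfg 0, le_rfl, le_sup_right⟩
    | succ i ih =>
      obtain ⟨h1, h2, h3, -⟩ := hnext i (G i) ih.2.1 ih.2.2
      exact ⟨h1, h2, h3⟩
  obtain ⟨i, hi⟩ := h.exists_eq_bot G (fun i => (hG i).1)
    fun i => (hnext i (G i) (hG i).2.1 (hG i).2.2).2.2.2
  have hUi : U i ≤ U (i + 1) := by simpa [hi] using (hG i).2.2
  refine ⟨m * i, fun v hv => ?_⟩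
  obtain ⟨w, -, hw⟩ := hUi (x := v) (by
    obtain ⟨w, rfl⟩ := hv
    exact ⟨w, trivial, by rw [hg, ← pow_mul]⟩)
  refine ⟨(f ^ (m - 1)) w, ?_⟩
  rw [← hw, hg, ← pow_mul, ← Module.End.mul_apply, ← pow_add]
  congr 2
  rw [mul_add]
  omega

/-- Over a right perfect ring square matrices are left `π`-regular. -/
theorem IsRightPerfectRing.exists_pow_eq_mul_pow_succ (h : IsRightPerfectRing R) {ι : Type*}
    [Fintype ι] [DecidableEq ι] (T : Matrix ι ι R) :
    ∃ (n : ℕ) (A : Matrix ι ι R), T ^ n = A * T ^ (n + 1) := by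
  obtain ⟨n, hn⟩ := h.exists_range_pow_le T.vecMulLinear
  have hpow : ∀ (m : ℕ) (v : ι → R), (T.vecMulLinear ^ m) v = Matrix.vecMul v (T ^ m) := by
    intro m v
    induction m with
    | zero => simp
    | succ m ih =>
      rw [pow_succ', Module.End.mul_apply, ih, Matrix.vecMulLinear_apply, Matrix.vecMul_vecMul,
        ← pow_succ]
  have H : ∀ i, ∃ a : ι → R, Matrix.vecMul a (T ^ (n + 1)) = (T ^ n) i := by
    intro i
    obtain ⟨a, ha⟩ := hn ⟨Pi.single i 1, rfl⟩
    refine ⟨a, ?_⟩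
    rw [← hpow, ha, hpow, Matrix.single_one_vecMul]
    rfl
  choose A hA using H
  refine ⟨n, Matrix.of A, ?_⟩
  ext i j
  rw [← hA i]
  rfl

end PerfectRings

/-! ### Comatrices -/

section Comatrix

variable {k : Type*} {C : Type v} [Field k] [AddCommGroup C] [Module k C] [Coalgebra k C]
  {ι : Type*} [Fintype ι] [DecidableEq ι]

variable (k) in
/-- A square matrix over a coalgebra is a comatrix (a multiplicative matrix) if
`Δ(tᵢⱼ) = ∑ₗ tᵢₗ ⊗ tₗⱼ` and `ε(tᵢⱼ) = δᵢⱼ`. -/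
structure IsComatrix (T : Matrix ι ι C) : Prop where
  comul_apply : ∀ i j, Coalgebra.comul (R := k) (T i j) = ∑ l, T i l ⊗ₜ[k] T l j
  counit_apply : ∀ i j, Coalgebra.counit (R := k) (T i j) = (1 : Matrix ι ι k) i j

/-- The finiteness theorem for comodules: every element lies in a finite-dimensional right
subcomodule. It is recorded by a finite family `x` with `y = ∑ aᵢxᵢ` and
`Δ(xⱼ) = ∑ᵢ xᵢ ⊗ βᵢⱼ`. -/
theorem exists_finite_comul_eq_sum (y : C) :
    ∃ (s : Type v) (_ : Fintype s) (x : s → C) (β : s → s → C),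
      y ∈ Submodule.span k (Set.range x) ∧
      ∀ j, Coalgebra.comul (R := k) (x j) = ∑ i, x i ⊗ₜ[k] β i j := by
  let b := Module.Basis.ofVectorSpace k C
  obtain ⟨x, hx⟩ := TensorProduct.eq_repr_basis_right b (Coalgebra.comul (R := k) y)
  replace hx : Coalgebra.comul (R := k) y = ∑ i : x.support, x i ⊗ₜ[k] b i := by
    rw [← hx, Finsupp.sum, ← Finset.sum_coe_sort]
  -- `q j` is `id ⊗ b*ⱼ`, the coefficient of `b j`
  let q : _ → C ⊗[k] C →ₗ[k] C := fun j =>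
    (TensorProduct.rid k C).toLinearMap ∘ₗ (b.coord j).lTensor C
  refine ⟨x.support, inferInstance, fun i => x i, fun i j => q j (Coalgebra.comul (b i)), ?_, ?_⟩
  · have h1 := congrArg (TensorProduct.rid k C) (Coalgebra.lTensor_counit_comul (R := k) y)
    simp only [hx, map_sum, LinearMap.lTensor_tmul, TensorProduct.rid_tmul, one_smul] at h1
    rw [← h1]
    exact Submodule.sum_mem _ fun i _ => Submodule.smul_mem _ _ (Submodule.subset_span ⟨i, rfl⟩)
  · intro j
    have h1 := congrArg ((q j).lTensor C) (Coalgebra.coassoc_apply (R := k) y)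
    have h2 : ∀ (z : C ⊗[k] C) (c : C),
        (q j).lTensor C (TensorProduct.assoc k C C C (z ⊗ₜ[k] c)) = b.coord j c • z := by
      intro z c
      induction z using TensorProduct.induction_on with
      | zero => simp
      | tmul x y => simp [q]
      | add x y hx hy => simp only [TensorProduct.add_tmul, map_add, hx, hy, smul_add]
    rw [hx] at h1
    simp only [map_sum, LinearMap.rTensor_tmul, LinearMap.lTensor_tmul, h2] at h1
    rw [← h1, Finset.sum_eq_single j]
    · simp
    · intro i _ hij
      have : i.1 ≠ j.1 := fun h => hij (Subtype.ext h)
      simp [this]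
    · simp

/-- Every element of a coalgebra lies in the span of a finite family `c` which spans a right
subcomodule and whose coefficients form a comatrix. -/
theorem exists_isComatrix (y : C) :
    ∃ (n : ℕ) (c : Fin n → C) (T : Matrix (Fin n) (Fin n) C), IsComatrix k T ∧
      (∀ j, Coalgebra.comul (R := k) (c j) = ∑ i, c i ⊗ₜ[k] T i j) ∧
      y ∈ Submodule.span k (Set.range c) := by
  obtain ⟨s, _, x, β, hy, hx⟩ := exists_finite_comul_eq_sum (k := k) y
  set V := Submodule.span k (Set.range x) with hV
  have : FiniteDimensional k V := FiniteDimensional.span_of_finite k (Set.finite_range x)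
  let b := Module.finBasis k V
  obtain ⟨π, hπ⟩ := V.subtype.exists_leftInverse_of_injective V.ker_subtype
  have hπ' : ∀ v : V, π v = v := fun v => LinearMap.congr_fun hπ v
  let φ : Fin (Module.finrank k V) → C →ₗ[k] k := fun i => b.coord i ∘ₗ π
  have hφ : ∀ i j, φ i (b j) = (1 : Matrix _ _ k) i j := by
    intro i j
    simp [φ, hπ', Matrix.one_apply, Finsupp.single_apply, eq_comm]
  have hsum : ∀ v ∈ V, ∑ i, φ i v • (b i : C) = v := by
    intro v hv
    have h1 := congrArg V.subtype (b.sum_repr ⟨v, hv⟩)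
    have h2 : π v = ⟨v, hv⟩ := hπ' ⟨v, hv⟩
    simp only [map_sum, map_smul] at h1
    simp only [φ, LinearMap.comp_apply, h2, Module.Basis.coord_apply]
    exact h1
  -- `p i` is `φ i ⊗ id`, the coefficient of `b i`
  let p : Fin (Module.finrank k V) → C ⊗[k] C →ₗ[k] C := fun i =>
    (TensorProduct.lid k C).toLinearMap ∘ₗ (φ i).rTensor C
  have hp : ∀ v ∈ V, Coalgebra.comul (R := k) v =
      ∑ i, (b i : C) ⊗ₜ[k] p i (Coalgebra.comul v) := by
    intro v hv
    induction hv using Submodule.span_induction with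
    | mem v hv =>
      obtain ⟨j, rfl⟩ := hv
      rw [hx]
      simp only [map_sum, TensorProduct.tmul_sum]
      rw [Finset.sum_comm]
      refine Finset.sum_congr rfl fun l _ => ?_
      simp only [p, LinearMap.comp_apply, LinearMap.rTensor_tmul, LinearEquiv.coe_coe,
        TensorProduct.lid_tmul, ← TensorProduct.smul_tmul]
      rw [← TensorProduct.sum_tmul, hsum _ (Submodule.subset_span ⟨l, rfl⟩)]
    | zero => simp
    | add v w _ _ hv hw =>
      simp only [map_add, TensorProduct.tmul_add, Finset.sum_add_distrib, ← hv, ← hw]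
    | smul a v _ hv => simp only [map_smul, TensorProduct.tmul_smul, ← Finset.smul_sum, ← hv]
  refine ⟨_, fun i => (b i : C), Matrix.of fun i j => p i (Coalgebra.comul (b j : C)), ⟨?_, ?_⟩,
    fun j => hp _ (b j).2, ?_⟩
  · intro l j
    have h1 := Coalgebra.coassoc_apply (R := k) (b j : C)
    rw [hp _ (b j).2] at h1
    simp only [map_sum, LinearMap.rTensor_tmul, LinearMap.lTensor_tmul] at h1
    let P : C ⊗[k] (C ⊗[k] C) →ₗ[k] C ⊗[k] C :=
      (TensorProduct.lid k (C ⊗[k] C)).toLinearMap ∘ₗ (φ l).rTensor _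
    have h2 := congrArg P h1
    have h3 : ∀ (z : C ⊗[k] C) (c : C),
        P (TensorProduct.assoc k C C C (z ⊗ₜ[k] c)) = p l z ⊗ₜ[k] c := by
      intro z c
      induction z using TensorProduct.induction_on with
      | zero => simp
      | tmul x y => simp [P, p, TensorProduct.smul_tmul']
      | add x y hx hy => simp only [TensorProduct.add_tmul, map_add, hx, hy]
    simp only [map_sum, h3] at h2
    simp only [P, LinearMap.comp_apply, LinearMap.rTensor_tmul, LinearEquiv.coe_coe,
      TensorProduct.lid_tmul, hφ, Matrix.one_apply, ite_smul, one_smul, zero_smul,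
      Finset.sum_ite_eq, Finset.mem_univ, if_true] at h2
    exact h2.symm
  · intro i j
    have h1 := Coalgebra.lTensor_counit_comul (R := k) (b j : C)
    have h2 : ∀ z : C ⊗[k] C, Coalgebra.counit (R := k) (p i z) =
        φ i ((TensorProduct.rid k C) ((Coalgebra.counit (R := k)).lTensor C z)) := by
      intro z
      induction z using TensorProduct.induction_on with
      | zero => simp
      | tmul x y => simp [p, mul_comm]
      | add x y hx hy => simp only [map_add, hx, hy]
    rw [Matrix.of_apply, h2, h1, TensorProduct.rid_tmul, one_smul, hφ]
  · have h1 : Submodule.span k (Set.range fun i => (b i : C)) = V := by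
      rw [show (Set.range fun i => (b i : C)) = V.subtype '' Set.range b by
        rw [← Set.range_comp]; rfl, Submodule.span_image, b.span_eq, Submodule.map_subtype_top]
    rw [h1]
    exact hy

end Comatrix

/-! ### The coalgebra `B ⊘ B` -/

/-- If `M` is left `π`-regular and `v 1` is divisible by the powers of `M` along the sequence `v`,
then `M` has a left inverse on `v 1`. -/
theorem eq_smul_of_pow_eq_mul_pow_succ {A V : Type*} [Monoid A] [MulAction A V] {M C : A} {n : ℕ}
    (hM : M ^ n = C * M ^ (n + 1)) {v : ℕ → V} (hv : ∀ p, M • v (p + 1) = v p) :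
    v 1 = C • v 0 := by
  have hpow : ∀ m p, M ^ m • v (p + m) = v p := by
    intro m
    induction m with
    | zero => simp
    | succ m ih => intro p; rw [pow_succ, mul_smul, ← add_assoc, hv, ih]
  rw [← hpow n 1, hM, mul_smul, add_comm 1 n]
  congr 1
  simpa using hpow (n + 1) 0

section RightPerfect

theorem isRightPerfectRing_of_finiteDimensional (k B : Type*) [Field k] [Ring B] [Algebra k B]
    [FiniteDimensional k B] : IsRightPerfectRing B := by
  intro a ha
  have : IsArtinianRing B := isArtinian_of_tower k inferInstance
  obtain ⟨n, hn⟩ := IsArtinian.monotone_stabilizes (R := B) (M := B)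
    ⟨fun n => OrderDual.toDual (Ideal.span {a n}), fun i j h => ha h⟩
  exact ⟨n, fun m hm => (hn m hm).symm⟩

theorem IsRightPerfectRing.of_surjective {R S : Type*} [Ring R] [Ring S]
    (h : IsRightPerfectRing R) (f : R →+* S) (hf : Function.Surjective f) :
    IsRightPerfectRing S := by
  intro a ha
  have H : ∀ n, ∃ r, a (n + 1) = f r * a n := by
    intro n
    have : a (n + 1) ∈ Ideal.span {a n} :=
      ha n.le_succ (Ideal.mem_span_singleton_self _)
    obtain ⟨s, hs⟩ := Ideal.mem_span_singleton'.1 this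
    obtain ⟨r, rfl⟩ := hf s
    exact ⟨r, hs.symm⟩
  choose r hr using H
  obtain ⟨b₀, hb₀⟩ := hf (a 0)
  let b : ℕ → R := fun n => n.rec b₀ fun n x => r n * x
  have hb : ∀ n, f (b n) = a n := by
    intro n
    induction n with
    | zero => exact hb₀
    | succ n ih => rw [hr, ← ih, ← map_mul]
  obtain ⟨n, hn⟩ := h b (antitone_nat_of_succ_le fun n => by
    rw [Ideal.span_singleton_le_iff_mem]
    exact Ideal.mul_mem_left _ _ (Ideal.mem_span_singleton_self _))
  refine ⟨n, fun m hm => le_antisymm (ha hm) ?_⟩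
  have h1 : b n ∈ Ideal.span {b m} := by rw [hn m hm]; exact Ideal.mem_span_singleton_self _
  obtain ⟨c, hc⟩ := Ideal.mem_span_singleton'.1 h1
  rw [Ideal.span_singleton_le_iff_mem, ← hb, ← hb, ← hc, map_mul]
  exact Ideal.mul_mem_left _ _ (Ideal.mem_span_singleton_self _)

end RightPerfect

section Oslash

variable {k : Type u} {B : Type v} [Field k] [Ring B] [Bialgebra k B]

variable (k B) in
/-- `(B ⊗ B)B⁺` as a left ideal of `B ⊗ B`. -/
def augIdeal : Ideal (B ⊗[k] B) where
  __ := (augSubmodule k B).toAddSubmonoid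
  smul_mem' := fun s _ hz => mul_mem_augSubmodule s hz

theorem mem_augIdeal {z : B ⊗[k] B} : z ∈ augIdeal k B ↔ z ∈ augSubmodule k B := Iff.rfl

theorem mem_kerI {b : B} : b ∈ kerI k B ↔ b ⊗ₜ[k] (1 : B) ∈ augSubmodule k B :=
  iMap_eq_zero_iff k B b

theorem Oslash.mk_eq_mk {x y x' y' : B} :
    Oslash.mk k x y = Oslash.mk k x' y' ↔
      (augIdeal k B).mkQ (x ⊗ₜ[k] y) = (augIdeal k B).mkQ (x' ⊗ₜ[k] y') := by
  rw [Submodule.mkQ_apply, Submodule.mkQ_apply, Submodule.Quotient.eq, mem_augIdeal]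
  exact Submodule.Quotient.eq _

/-- The defining relation of `B ⊘ B`, for the entries of a comatrix. -/
theorem sum_mkQ_mul_comatrix {ι : Type*} [Fintype ι] [DecidableEq ι] {T : Matrix ι ι B}
    (hT : IsComatrix k T) (t : B ⊗[k] B) (i j : ι) :
    ∑ l, (augIdeal k B).mkQ (t * (T i l ⊗ₜ[k] T l j)) =
      (augIdeal k B).mkQ ((1 : Matrix ι ι k) i j • t) := by
  rw [← map_sum, ← Finset.mul_sum, ← hT.comul_apply, ← hT.counit_apply, Submodule.mkQ_apply,
    Submodule.mkQ_apply, Submodule.Quotient.eq, mem_augIdeal, ← Submodule.Quotient.eq]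
  exact (mkQ_mul_comul _ _).trans (map_smul _ _ _).symm

open scoped Matrix.Module

/-- `ker(i_B)` is stable under right multiplication by the entries of a comatrix `T`. The rows
`κTᵖ ⊘ 1` satisfy `(1 ⊗ Tᵗ)(κTᵖ⁺¹ ⊘ 1) = κTᵖ ⊘ 1`, so the first of them vanishes with the zeroth. -/
theorem mul_comatrix_mem_kerI (hB : IsRightPerfectRing B) {ι : Type*} [Fintype ι] [DecidableEq ι]
    {T : Matrix ι ι B} (hT : IsComatrix k T) {κ : B} (hκ : κ ∈ kerI k B) (i j : ι) :
    κ * T i j ∈ kerI k B := by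
  obtain ⟨n, C, hC⟩ := hB.exists_pow_eq_mul_pow_succ T.transpose
  let inr : B →+* B ⊗[k] B := (Algebra.TensorProduct.includeRight : B →ₐ[k] B ⊗[k] B)
  have hM := congrArg inr.mapMatrix hC
  rw [map_mul, map_pow, map_pow] at hM
  let v : ℕ → ι → (B ⊗[k] B) ⧸ augIdeal k B := fun p j =>
    (augIdeal k B).mkQ ((κ * (T ^ p) i j) ⊗ₜ[k] (1 : B))
  have hv : ∀ p, inr.mapMatrix T.transpose • v (p + 1) = v p := by
    intro p
    funext j
    have h1 : ∀ l, inr.mapMatrix T.transpose j l • v (p + 1) l =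
        ∑ m, (augIdeal k B).mkQ (((κ * (T ^ p) i m) ⊗ₜ[k] (1 : B)) * (T m l ⊗ₜ[k] T l j)) := by
      intro l
      rw [← map_smul, ← map_sum, smul_eq_mul]
      congr 1
      simp [inr, pow_succ, Matrix.mul_apply, Finset.mul_sum, TensorProduct.sum_tmul, mul_assoc]
    rw [Matrix.Module.smul_apply, Finset.sum_congr rfl fun l _ => h1 l, Finset.sum_comm]
    rw [Finset.sum_congr rfl fun m _ => sum_mkQ_mul_comatrix hT _ m j, ← map_sum]
    simp [v, Matrix.one_apply]
  have h1 := congrFun (eq_smul_of_pow_eq_mul_pow_succ hM hv) j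
  have h0 : v 0 = 0 := by
    funext j
    refine (Submodule.Quotient.mk_eq_zero _).2 ?_
    rw [pow_zero, Matrix.one_apply]
    split_ifs
    · rw [mul_one]; exact mem_kerI.1 hκ
    · simp
  rw [h0, smul_zero] at h1
  have h2 := (Submodule.Quotient.mk_eq_zero _).1 h1
  rw [pow_one] at h2
  exact mem_kerI.2 h2

theorem smul_mem_kerI {b : B} (hb : b ∈ kerI k B) (a : k) : a • b ∈ kerI k B := by
  rw [Algebra.smul_def]
  exact Ideal.mul_mem_left _ _ hb

theorem eq_sum_counit_smul_of_comul_eq {ι : Type*} {c : ι → B} [Fintype ι] {T : Matrix ι ι B}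
    (hc : ∀ j, Coalgebra.comul (R := k) (c j) = ∑ i, c i ⊗ₜ[k] T i j) (j : ι) :
    c j = ∑ i, Coalgebra.counit (R := k) (c i) • T i j := by
  have h := congrArg (TensorProduct.lid k B) (Coalgebra.rTensor_counit_comul (R := k) (c j))
  rw [hc] at h
  simpa using h.symm

variable (k B) in
/-- The set of the entries of all comatrices over `B`. -/
def comatrixEntries : Set B :=
  {b | ∃ (n : ℕ) (T : Matrix (Fin n) (Fin n) B) (i j : Fin n), IsComatrix k T ∧ b = T i j}

variable (k B) in
theorem span_comatrix_eq_top : Submodule.span k (comatrixEntries k B) = ⊤ := by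
  rw [eq_top_iff]
  rintro b -
  obtain ⟨n, c, T, hT, hc, hb⟩ := exists_isComatrix (k := k) b
  refine Submodule.span_le.2 ?_ hb
  rintro _ ⟨j, rfl⟩
  rw [eq_sum_counit_smul_of_comul_eq hc j]
  exact Submodule.sum_mem _ fun i _ => Submodule.smul_mem _ _
    (Submodule.subset_span ⟨n, T, i, j, hT, rfl⟩)

theorem mul_mem_kerI (hB : IsRightPerfectRing B) {κ : B} (hκ : κ ∈ kerI k B) (b : B) :
    κ * b ∈ kerI k B := by
  have hb : b ∈ Submodule.span k (comatrixEntries k B) := by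
    rw [span_comatrix_eq_top]; trivial
  induction hb using Submodule.span_induction with
  | mem b hb =>
    obtain ⟨n, T, i, j, hT, rfl⟩ := hb
    exact mul_comatrix_mem_kerI hB hT hκ i j
  | zero => simp
  | add x y _ _ hx hy => rw [mul_add]; exact add_mem hx hy
  | smul a x _ hx => rw [mul_smul_comm]; exact smul_mem_kerI hx a

/-- For a comatrix `T` there is a matrix `A` with `1 ⊘ tᵢⱼ = aᵢⱼ ⊘ 1`. Here the columns `v p` with
entries `1 ⊘ (T · T ⋯ T)ᵢⱼ`, the products being formed in the opposite ring, satisfy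
`(T ⊗ 1) v (p + 1) = v p`. -/
theorem exists_mk_one_comatrix_eq (hB : IsRightPerfectRing B) {ι : Type*} [Fintype ι]
    [DecidableEq ι] {T : Matrix ι ι B} (hT : IsComatrix k T) :
    ∃ (n : ℕ) (A : Matrix ι ι B), T ^ n = A * T ^ (n + 1) ∧
      ∀ i j, Oslash.mk k 1 (T i j) = Oslash.mk k (A i j) 1 := by
  obtain ⟨n, A, hA⟩ := hB.exists_pow_eq_mul_pow_succ T
  refine ⟨n, A, hA, fun i j => ?_⟩
  let inl : B →+* B ⊗[k] B := (Algebra.TensorProduct.includeLeft : B →ₐ[k] B ⊗[k] B)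
  have hM := congrArg inl.mapMatrix hA
  rw [map_mul, map_pow, map_pow] at hM
  let y : ℕ → ι → B := fun p => p.rec (fun i => (1 : Matrix ι ι B) i j)
    fun _ y i => ∑ l, y l * T i l
  have hy : ∀ p i, y (p + 1) i = ∑ l, y p l * T i l := fun p i => rfl
  have hy0 : ∀ i, y 0 i = (1 : Matrix ι ι B) i j := fun i => rfl
  let v : ℕ → ι → (B ⊗[k] B) ⧸ augIdeal k B := fun p i =>
    (augIdeal k B).mkQ ((1 : B) ⊗ₜ[k] y p i)
  have hv : ∀ p, inl.mapMatrix T • v (p + 1) = v p := by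
    intro p
    funext i
    have h1 : ∀ l, inl.mapMatrix T i l • v (p + 1) l =
        ∑ m, (augIdeal k B).mkQ (((1 : B) ⊗ₜ[k] y p m) * (T i l ⊗ₜ[k] T l m)) := by
      intro l
      rw [← map_smul, ← map_sum, smul_eq_mul, hy]
      congr 1
      simp [inl, TensorProduct.tmul_sum, Finset.mul_sum]
    rw [Matrix.Module.smul_apply, Finset.sum_congr rfl fun l _ => h1 l, Finset.sum_comm]
    rw [Finset.sum_congr rfl fun m _ => sum_mkQ_mul_comatrix hT _ i m, ← map_sum]
    simp [v, Matrix.one_apply]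
  have h1 := congrFun (eq_smul_of_pow_eq_mul_pow_succ hM hv) i
  rw [Oslash.mk_eq_mk]
  have h2 : y 1 i = T i j := by simp [hy, hy0, Matrix.one_apply]
  have h3 : ∀ l, inl.mapMatrix A i l • v 0 l =
      (augIdeal k B).mkQ ((1 : Matrix ι ι k) l j • (A i l ⊗ₜ[k] (1 : B))) := by
    intro l
    rw [← map_smul, smul_eq_mul]
    congr 1
    by_cases hl : l = j <;> simp [inl, hy0, Matrix.one_apply, hl]
  rw [Matrix.Module.smul_apply, Finset.sum_congr rfl fun l _ => h3 l, ← map_sum] at h1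
  rw [← h2]
  refine h1.trans ?_
  simp [Matrix.one_apply]

end Oslash

/-! ### The antipode and the universal property -/

section Antipode

variable {k : Type u} {B : Type v} {Q : Type v'} [Field k] [Ring B] [Bialgebra k B] [Ring Q]
  [Bialgebra k Q]

/-- If `s` is a right convolution inverse of a bialgebra map `q` into a right perfect bialgebra
`Q`, then `s` vanishes on `ker q`. For a subcomodule spanned by a family `c`, with comatrix `T`, the
rows `(G(q(cⱼ)))ⱼ` with `G : Q → Q` linear form a submodule of `Qⁿ`, the range of a scalar matrix
`P`, which is stable under right multiplication by `q(T)`. By left `π`-regularity of `P q(T)` it is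
also stable under `q(T)⁻¹`; as it contains `(ε(cⱼ))ⱼ`, it contains `(s(cⱼ))ⱼ`. -/
theorem eq_zero_of_comatrix_inverse (hQ : IsRightPerfectRing Q) (q : B →ₐc[k] Q) (s : B →ₗ[k] Q)
    (hqs : ∀ (n : ℕ) (T : Matrix (Fin n) (Fin n) B), IsComatrix k T → T.map q * T.map s = 1)
    {y : B} (hy : q y = 0) : s y = 0 := by
  obtain ⟨n, c, T, hT, hc, hyc⟩ := exists_isComatrix (k := k) y
  obtain ⟨μ, rfl⟩ := (Submodule.mem_span_range_iff_exists_fun k).1 hyc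
  -- `r` is a generalized inverse of `u`, `u r u = u`, and `P` below is the matrix of `r u`
  let u : (Fin n → k) →ₗ[k] Q := Fintype.linearCombination k (fun j => q (c j))
  obtain ⟨r₀, hr₀⟩ := u.rangeRestrict.exists_rightInverse_of_surjective u.range_rangeRestrict
  obtain ⟨r, hr⟩ := LinearMap.exists_extend r₀
  have hr' : ∀ j, ∑ l, r (q (c j)) l • q (c l) = q (c j) := by
    intro j
    have hj : u (Pi.single j 1) = q (c j) := by simp [u, Fintype.linearCombination_apply_single]
    have h1 : r (q (c j)) = r₀ ⟨q (c j), ⟨_, hj⟩⟩ := LinearMap.congr_fun hr ⟨q (c j), ⟨_, hj⟩⟩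
    have h2 : u (r₀ ⟨q (c j), ⟨_, hj⟩⟩) = q (c j) :=
      congrArg Subtype.val (LinearMap.congr_fun hr₀ ⟨q (c j), ⟨_, hj⟩⟩)
    rw [h1]
    exact h2
  let P : Matrix (Fin n) (Fin n) Q := Matrix.of fun l j => algebraMap k Q (r (q (c j)) l)
  have hP : ∀ (G : Q →ₗ[k] Q) (j : Fin n), ∑ l, G (q (c l)) * P l j = G (q (c j)) := by
    intro G j
    conv_rhs => rw [← hr' j]
    simp only [map_sum, map_smul, P, Matrix.of_apply]
    exact Finset.sum_congr rfl fun l _ => by rw [Algebra.smul_def, Algebra.commutes]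
  set M := T.map q with hM
  have hcomul : ∀ j, Coalgebra.comul (R := k) (q (c j)) = ∑ i, q (c i) ⊗ₜ[k] M i j := by
    intro j
    rw [← CoalgHomClass.map_comp_comul_apply, hc]
    simp [hM]
  have hPMP : P * M * P = P * M := by
    ext l j
    let G : Q →ₗ[k] Q := LinearMap.mul' k Q ∘ₗ
      (Algebra.linearMap k Q ∘ₗ LinearMap.proj l ∘ₗ r).rTensor Q ∘ₗ Coalgebra.comul
    have hG : ∀ j, G (q (c j)) = (P * M) l j := by
      intro j
      simp [G, hcomul, Matrix.mul_apply, P]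
    rw [Matrix.mul_apply, ← hG, ← hP]
    exact Finset.sum_congr rfl fun m _ => by rw [hG]
  have hpow : ∀ p, (P * M) ^ (p + 1) = P * M ^ (p + 1) := by
    intro p
    induction p with
    | zero => simp
    | succ p ih => rw [pow_succ', ih, ← mul_assoc, hPMP, pow_succ' M (p + 1), mul_assoc]
  obtain ⟨m, A, hA⟩ := hQ.exists_pow_eq_mul_pow_succ (P * M)
  -- cancel the invertible matrix `M` in the power identity for `P * M`
  have hPA : P = A * P * M := by
    have h1 : (P * M) ^ (m + 1) = A * (P * M) ^ (m + 1 + 1) := by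
      rw [pow_succ, hA, mul_assoc, ← pow_succ]
    have h2 : M ^ (m + 1) * (T.map s) ^ (m + 1) = 1 := pow_mul_pow_eq_one _ (hqs n T hT)
    rw [hpow, hpow] at h1
    calc P = P * M ^ (m + 1) * (T.map s) ^ (m + 1) := by rw [mul_assoc, h2, mul_one]
      _ = A * P * M * (M ^ (m + 1) * (T.map s) ^ (m + 1)) := by
        rw [h1, pow_succ' M (m + 1)]; simp only [mul_assoc]
      _ = A * P * M := by rw [h2, mul_one]
  let e : Fin n → Q := fun j => algebraMap k Q (Coalgebra.counit (R := k) (c j))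
  have heP : Matrix.vecMul e P = e := by
    funext j
    have := hP (Algebra.linearMap k Q ∘ₗ Coalgebra.counit) j
    simpa [e, Matrix.vecMul, dotProduct] using this
  -- `e M⁻¹` is the row of the `s (c j)`, and `e M⁻¹ = e P M⁻¹ = e A P`
  have hs : ∀ j, s (c j) = Matrix.vecMul e (A * P) j := by
    intro j
    have h1 : Matrix.vecMul e (T.map s) = Matrix.vecMul e (A * P) := by
      conv_lhs => rw [← heP, hPA]
      rw [Matrix.vecMul_vecMul, mul_assoc, hM, hqs n T hT, mul_one]
    rw [← h1]
    conv_lhs => rw [eq_sum_counit_smul_of_comul_eq hc j]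
    simp [e, Matrix.vecMul, dotProduct, ← Algebra.smul_def]
  have hs' : ∀ j, s (c j) = ∑ l, r (q (c j)) l • Matrix.vecMul e A l := by
    intro j
    rw [hs, ← Matrix.vecMul_vecMul]
    simp only [Matrix.vecMul, dotProduct, P, Matrix.of_apply]
    exact Finset.sum_congr rfl fun l _ => by rw [Algebra.smul_def, Algebra.commutes]
  have key : s (∑ j, μ j • c j) = ∑ l, r (q (∑ j, μ j • c j)) l • Matrix.vecMul e A l := by
    simp only [map_sum, map_smul, hs', Finset.sum_apply, Pi.smul_apply, smul_eq_mul,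
      Finset.sum_smul, Finset.smul_sum, mul_smul]
    exact Finset.sum_comm
  rw [key, hy]
  simp

end Antipode

section Main

variable {k : Type u} {B : Type v} [Field k] [Ring B] [Bialgebra k B]

variable (k B) in
theorem comul_iMap (b : B) : Coalgebra.comul (R := k) (iMap k B b) =
    TensorProduct.map (iMap k B) (iMap k B) (Coalgebra.comul b) := by
  let p : B ⊗[k] B →ₗ[k] Oslash k B := (augSubmodule k B).mkQ
  have h1 : Coalgebra.comul (R := k) (iMap k B b) =
      TensorProduct.map p p
        (twistedComul k B (b ⊗ₜ[k] 1)) := rfl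
  have h2 : twistedComul k B (b ⊗ₜ[k] 1) = TensorProduct.tensorTensorTensorComm k B B B B
      (Coalgebra.comul b ⊗ₜ[k] (1 ⊗ₜ[k] 1)) := by
    simp [twistedComul, Cop.comulAux, Algebra.TensorProduct.one_def]
  rw [h1, h2]
  induction Coalgebra.comul (R := k) b using TensorProduct.induction_on with
  | zero => simp
  | tmul x y =>
    simp only [TensorProduct.tensorTensorTensorComm_tmul, TensorProduct.map_tmul]
    rfl
  | add x y hx hy => simp only [TensorProduct.add_tmul, map_add, hx, hy]

variable (k B) in
theorem counit_iMap (b : B) : Coalgebra.counit (R := k) (iMap k B b) = Coalgebra.counit b := by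
  rw [iMap_apply, Oslash.counit_mk, Bialgebra.counit_one, mul_one]

variable (k B) in
/-- The kernel of the coalgebra map `i_B` is a coideal. -/
theorem isCoideal_kerI : ((kerI k B).restrictScalars k).IsCoideal := by
  refine ⟨fun x hx => ?_, fun x hx => ?_⟩
  · rw [← counit_iMap, show iMap k B x = 0 from hx, map_zero]
  · let f := ((kerI k B).restrictScalars k).liftQ (iMap k B) (kerI_restrictScalars k B).le
    have hf : Function.Injective f := LinearMap.ker_eq_bot.1
      (Submodule.ker_liftQ_eq_bot _ _ _ (kerI_restrictScalars k B).ge)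
    have h1 : TensorProduct.map f f (TensorProduct.map ((kerI k B).restrictScalars k).mkQ
        ((kerI k B).restrictScalars k).mkQ (Coalgebra.comul x)) = 0 := by
      rw [← LinearMap.comp_apply, ← TensorProduct.map_comp, Submodule.liftQ_mkQ, ← comul_iMap,
        show iMap k B x = 0 from hx, map_zero]
    refine TensorProduct.map_injective_of_flat_flat f f hf hf ?_
    rw [h1, map_zero]

theorem Oslash.mk_mul_left {x y x' y' : B} (h : Oslash.mk k x y = Oslash.mk k x' y') (z : B) :
    Oslash.mk k (z * x) y = Oslash.mk k (z * x') y' := by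
  rw [Oslash.mk_eq_mk] at h ⊢
  have h1 := congrArg ((z ⊗ₜ[k] (1 : B)) • ·) h
  simpa only [← map_smul, smul_eq_mul, Algebra.TensorProduct.tmul_mul_tmul, one_mul] using h1

theorem exists_mk_one_eq_mk (hB : IsRightPerfectRing B) (y : B) :
    ∃ a, Oslash.mk k 1 y = Oslash.mk k a 1 := by
  let f : B →ₗ[k] Oslash k B := (augSubmodule k B).mkQ ∘ₗ TensorProduct.mk k B B 1
  suffices h : (LinearMap.range (iMap k B)).comap f = ⊤ by
    obtain ⟨a, ha⟩ := (h ▸ Submodule.mem_top : y ∈ (LinearMap.range (iMap k B)).comap f)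
    exact ⟨a, ha.symm⟩
  rw [eq_top_iff, ← span_comatrix_eq_top k B, Submodule.span_le]
  rintro _ ⟨n, T, i, j, hT, rfl⟩
  obtain ⟨-, A, -, hA⟩ := exists_mk_one_comatrix_eq hB hT
  exact ⟨A i j, (hA i j).symm⟩

theorem range_iMap (hB : IsRightPerfectRing B) : LinearMap.range (iMap k B) = ⊤ := by
  rw [eq_top_iff]
  rintro z -
  obtain ⟨z, rfl⟩ := (augSubmodule k B).mkQ_surjective z
  induction z using TensorProduct.induction_on with
  | zero => rw [map_zero]; exact zero_mem _
  | tmul x y =>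
    obtain ⟨a, ha⟩ := exists_mk_one_eq_mk (k := k) hB y
    have := Oslash.mk_mul_left ha x
    rw [mul_one] at this
    exact ⟨x * a, this.symm⟩
  | add x y hx hy => rw [map_add]; exact add_mem hx hy

theorem sum_mk_comatrix {n : ℕ} {T : Matrix (Fin n) (Fin n) B} (hT : IsComatrix k T)
    (i j : Fin n) : ∑ l, Oslash.mk k (T i l) (T l j) =
      (1 : Matrix (Fin n) (Fin n) k) i j • Oslash.mk k 1 1 := by
  have h := mkQ_mul_comul (k := k) 1 (T i j)
  rw [hT.comul_apply, hT.counit_apply, one_mul, map_sum] at h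
  exact h

/-- The kernel of `i_B` is killed by every bialgebra map `f` to a Hopf algebra, because
`x ⊘ y ↦ f(x)S(f(y))` is well defined. -/
theorem eq_zero_of_mem_kerI {L : Type w} [Ring L] [HopfAlgebra k L] (f : B →ₐc[k] L) {b : B}
    (hb : b ∈ kerI k B) : f b = 0 := by
  let S : L →ₗ[k] L := HopfAlgebra.antipode k
  let F : B →ₗ[k] L := (f : B →ₗc[k] L).toLinearMap
  have hF : ∀ x, F x = f x := fun _ => rfl
  let Φ : B ⊗[k] B →ₗ[k] L := LinearMap.mul' k L ∘ₗ TensorProduct.map F (S ∘ₗ F)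
  have hΦ : ∀ (t : B ⊗[k] B) (b : B),
      Φ (t * Coalgebra.comul b) = Coalgebra.counit (R := k) b • Φ t := by
    intro t b
    induction t using TensorProduct.induction_on with
    | zero => simp
    | add x y hx hy => rw [add_mul, map_add, hx, hy, map_add, smul_add]
    | tmul x y =>
      have h1 : ∀ z : B ⊗[k] B, Φ ((x ⊗ₜ[k] y) * z) =
          f x * LinearMap.mul' k L (S.lTensor L (TensorProduct.map F F z)) * S (f y) := by
        intro z
        induction z using TensorProduct.induction_on with
        | zero => simp
        | add z w hz hw => simp only [mul_add, map_add, hz, hw, add_mul]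
        | tmul z w =>
          simp [Φ, hF, S, HopfAlgebra.antipode_mul_antidistrib, mul_assoc]
      have h2 : TensorProduct.map F F (Coalgebra.comul b) = Coalgebra.comul (f b) :=
        CoalgHomClass.map_comp_comul_apply f b
      rw [h1, h2, HopfAlgebra.mul_antipode_lTensor_comul_apply]
      simp [Φ, hF, Algebra.algebraMap_eq_smul_one]
  have hker : ∀ z ∈ augSubmodule k B, Φ z = 0 := by
    intro z hz
    induction hz using Submodule.span_induction with
    | mem z hz =>
      obtain ⟨t, b, hb, rfl⟩ := hz
      rw [hΦ, hb, zero_smul]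
    | zero => simp
    | add x y _ _ hx hy => rw [map_add, hx, hy, add_zero]
    | smul a x _ hx => rw [map_smul, hx, smul_zero]
  simpa [Φ, hF, S] using hker _ (mem_kerI.1 hb)

section Quotient

variable [(kerI k B).IsTwoSided] [((kerI k B).restrictScalars k).IsCoideal]

theorem mkBialgHom_surjective :
    Function.Surjective (Bialgebra.Quotient.mkBialgHom (R := k) (kerI k B)) :=
  Ideal.Quotient.mk_surjective

variable (k B) in
/-- The linear isomorphism `B / ker(i_B) ≅ im(i_B)` induced by `i_B`, as a map into `B ⊘ B`. -/
noncomputable def iMapQuotient : (B ⧸ kerI k B) →ₗ[k] Oslash k B :=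
  ((kerI k B).restrictScalars k).liftQ (iMap k B) (kerI_restrictScalars k B).le

theorem iMapQuotient_mk (b : B) :
    iMapQuotient k B (Bialgebra.Quotient.mkBialgHom (R := k) (kerI k B) b) = Oslash.mk k b 1 :=
  rfl

theorem iMapQuotient_bijective (hB : IsRightPerfectRing B) :
    Function.Bijective (iMapQuotient k B) := by
  refine ⟨LinearMap.ker_eq_bot.1
    (Submodule.ker_liftQ_eq_bot _ _ _ (kerI_restrictScalars k B).ge), fun z => ?_⟩
  obtain ⟨b, rfl⟩ := (range_iMap (k := k) hB ▸ Submodule.mem_top : z ∈ LinearMap.range (iMap k B))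
  exact ⟨Bialgebra.Quotient.mkBialgHom (R := k) (kerI k B) b, rfl⟩

theorem counit_iMapQuotient (x : B ⧸ kerI k B) :
    Coalgebra.counit (R := k) (iMapQuotient k B x) = Coalgebra.counit x := by
  obtain ⟨b, rfl⟩ := mkBialgHom_surjective (k := k) x
  rw [iMapQuotient_mk, ← iMap_apply, counit_iMap, CoalgHomClass.counit_comp_apply]

theorem map_comul_iMapQuotient (x : B ⧸ kerI k B) :
    TensorProduct.map (iMapQuotient k B) (iMapQuotient k B) (Coalgebra.comul x) =
      Coalgebra.comul (iMapQuotient k B x) := by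
  obtain ⟨b, rfl⟩ := mkBialgHom_surjective (k := k) x
  rw [iMapQuotient_mk, ← iMap_apply, comul_iMap, ← CoalgHomClass.map_comp_comul_apply,
    ← LinearMap.comp_apply, ← TensorProduct.map_comp]
  rfl

variable (k) in
/-- `B / ker(i_B) ≅ B ⊘ B` as coalgebras, for a right perfect bialgebra `B`. -/
noncomputable def iMapEquiv (hB : IsRightPerfectRing B) : (B ⧸ kerI k B) ≃ₗc[k] Oslash k B :=
  { LinearEquiv.ofBijective (iMapQuotient k B) (iMapQuotient_bijective hB) with
    counit_comp := LinearMap.ext counit_iMapQuotient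
    map_comp_comul := LinearMap.ext map_comul_iMapQuotient }

theorem iMapEquiv_injective (hB : IsRightPerfectRing B) : Function.Injective (iMapEquiv k hB) :=
  (iMapQuotient_bijective hB).1

theorem iMapEquiv_mk (hB : IsRightPerfectRing B) (b : B) :
    iMapEquiv k hB (Bialgebra.Quotient.mkBialgHom (R := k) (kerI k B) b) = Oslash.mk k b 1 :=
  rfl

/-- The antipode of `B / ker(i_B)`, with `S(q(y)) ↦ 1 ⊘ y` under `B / ker(i_B) ≅ B ⊘ B`. -/
theorem exists_isAntipode (hB : IsRightPerfectRing B) :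
    ∃ S : (B ⧸ kerI k B) →ₗ[k] (B ⧸ kerI k B), IsAntipode k S ∧ ∀ y : B,
      iMapEquiv k hB (S (Bialgebra.Quotient.mkBialgHom (R := k) (kerI k B) y)) =
        Oslash.mk k 1 y := by
  set q := Bialgebra.Quotient.mkBialgHom (R := k) (kerI k B) with hq
  let s : B →ₗ[k] (B ⧸ kerI k B) := (iMapEquiv k hB).symm.toLinearEquiv.toLinearMap ∘ₗ
    (augSubmodule k B).mkQ ∘ₗ TensorProduct.mk k B B 1
  have hs : ∀ y, iMapEquiv k hB (s y) = Oslash.mk k 1 y := fun y =>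
    (iMapEquiv k hB).apply_symm_apply _
  have hinv : ∀ (n : ℕ) (T : Matrix (Fin n) (Fin n) B), IsComatrix k T →
      T.map q * T.map s = 1 ∧ T.map s * T.map q = 1 := by
    intro n T hT
    obtain ⟨m, A, hA, hTA⟩ := exists_mk_one_comatrix_eq hB hT
    have hsA : T.map s = A.map q := by
      ext i j
      apply iMapEquiv_injective hB
      rw [Matrix.map_apply, Matrix.map_apply, hs, hTA, iMapEquiv_mk]
    have h1 : T.map q * A.map q = 1 := by
      ext i j
      apply iMapEquiv_injective hB
      have h2 : (T.map q * A.map q) i j = q (∑ l, T i l * A l j) := by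
        simp [Matrix.mul_apply]
      have h3 : (1 : Matrix (Fin n) (Fin n) (B ⧸ kerI k B)) i j =
          q ((1 : Matrix (Fin n) (Fin n) k) i j • 1) := by
        by_cases hij : i = j <;> simp [Matrix.one_apply, hij]
      rw [h2, h3, map_smul, map_sum, map_sum, map_smul, iMapEquiv_mk, ← sum_mk_comatrix hT]
      refine Finset.sum_congr rfl fun l _ => ?_
      rw [iMapEquiv_mk, ← Oslash.mk_mul_left (hTA l j) (T i l), mul_one]
    have h4 : T.map q ^ m = A.map q * T.map q ^ (m + 1) := by
      have := congrArg ((q : B →+* B ⧸ kerI k B).mapMatrix) hA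
      rw [map_mul, map_pow, map_pow] at this
      exact this
    have h5 : T.map q ^ m * A.map q ^ m = 1 := pow_mul_pow_eq_one _ h1
    refine ⟨hsA ▸ h1, ?_⟩
    rw [hsA]
    calc A.map q * T.map q = A.map q * T.map q * (T.map q ^ m * A.map q ^ m) := by
          rw [h5, mul_one]
      _ = T.map q ^ m * A.map q ^ m := by
          conv_rhs => rw [h4, pow_succ']
          simp only [mul_assoc]
      _ = 1 := h5
  have hQ : IsRightPerfectRing (B ⧸ kerI k B) :=
    hB.of_surjective (Ideal.Quotient.mk (kerI k B)) Ideal.Quotient.mk_surjective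
  have hker : (kerI k B).restrictScalars k ≤ LinearMap.ker s := fun y hy =>
    eq_zero_of_comatrix_inverse hQ q s (fun n T hT => (hinv n T hT).1)
      (Ideal.Quotient.eq_zero_iff_mem.2 hy)
  let S : (B ⧸ kerI k B) →ₗ[k] (B ⧸ kerI k B) := ((kerI k B).restrictScalars k).liftQ s hker
  have hS : ∀ y, S (q y) = s y := fun y => rfl
  have hspan : Submodule.span k (q '' (comatrixEntries k B)) = ⊤ := by
    have hq' : Function.Surjective (q : B →ₗ[k] B ⧸ kerI k B) := mkBialgHom_surjective
    have := Submodule.map_span (q : B →ₗ[k] B ⧸ kerI k B) (comatrixEntries k B)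
    rw [span_comatrix_eq_top, Submodule.map_top, LinearMap.range_eq_top.2 hq'] at this
    exact this.symm
  have hcomul : ∀ (n : ℕ) (T : Matrix (Fin n) (Fin n) B), IsComatrix k T → ∀ i j,
      Coalgebra.comul (R := k) (q (T i j)) = ∑ l, q (T i l) ⊗ₜ[k] q (T l j) := by
    intro n T hT i j
    rw [← CoalgHomClass.map_comp_comul_apply, hT.comul_apply]
    simp
  have hcounit : ∀ (n : ℕ) (T : Matrix (Fin n) (Fin n) B), IsComatrix k T → ∀ i j,
      algebraMap k (B ⧸ kerI k B) (Coalgebra.counit (R := k) (q (T i j))) =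
        (1 : Matrix (Fin n) (Fin n) (B ⧸ kerI k B)) i j := by
    intro n T hT i j
    rw [CoalgHomClass.counit_comp_apply, hT.counit_apply]
    by_cases hij : i = j <;> simp [Matrix.one_apply, hij]
  refine ⟨S, ⟨LinearMap.ext_on hspan ?_, LinearMap.ext_on hspan ?_⟩, hs⟩
  · rintro _ ⟨_, ⟨n, T, i, j, hT, rfl⟩, rfl⟩
    simp only [LinearMap.comp_apply, hcomul n T hT, map_sum, LinearMap.rTensor_tmul,
      LinearMap.mul'_apply, hS, Algebra.linearMap_apply, hcounit n T hT]
    rw [← (hinv n T hT).2, Matrix.mul_apply]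
    rfl
  · rintro _ ⟨_, ⟨n, T, i, j, hT, rfl⟩, rfl⟩
    simp only [LinearMap.comp_apply, hcomul n T hT, map_sum, LinearMap.lTensor_tmul,
      LinearMap.mul'_apply, hS, Algebra.linearMap_apply, hcounit n T hT]
    rw [← (hinv n T hT).1, Matrix.mul_apply]
    rfl

theorem existsUnique_comp_mkBialgHom {L : Type w} [Ring L] [HopfAlgebra k L] (f : B →ₐc[k] L) :
    ∃! g : (B ⧸ kerI k B) →ₐc[k] L,
      g.comp (Bialgebra.Quotient.mkBialgHom (R := k) (kerI k B)) = f := by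
  let g₀ : (B ⧸ kerI k B) →ₐ[k] L :=
    Ideal.Quotient.liftₐ (kerI k B) (f : B →ₐ[k] L) fun b hb => eq_zero_of_mem_kerI f hb
  let g : (B ⧸ kerI k B) →ₐc[k] L := .ofAlgHom g₀
    (Ideal.Quotient.algHom_ext k (AlgHom.ext fun b => CoalgHomClass.counit_comp_apply f b))
    (Ideal.Quotient.algHom_ext k (AlgHom.ext fun b => by
      refine Eq.trans ?_ (CoalgHomClass.map_comp_comul_apply f b)
      change TensorProduct.map g₀.toLinearMap g₀.toLinearMap
        (TensorProduct.map (Ideal.Quotient.mkₐ k (kerI k B)).toLinearMap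
          (Ideal.Quotient.mkₐ k (kerI k B)).toLinearMap (Coalgebra.comul b)) = _
      rw [← LinearMap.comp_apply, ← TensorProduct.map_comp]
      rfl))
  refine ⟨g, BialgHom.ext fun b => rfl, fun g' hg' => BialgHom.ext fun x => ?_⟩
  obtain ⟨b, rfl⟩ := mkBialgHom_surjective (k := k) x
  exact congrArg (fun h : B →ₐc[k] L => h b) hg'

end Quotient

end Main

theorem mainTheorem3 {k : Type u} {B : Type v} [Field k] [Ring B] [Bialgebra k B]
    (hB : FiniteDimensional k B ∨ IsRightPerfectRing B) :
    ∃ (_ : (kerI k B).IsTwoSided) (_ : ((kerI k B).restrictScalars k).IsCoideal)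
      (S : (B ⧸ kerI k B) →ₗ[k] (B ⧸ kerI k B)),
      IsAntipode k S ∧
      IsHopfEnvelope.{w} (Bialgebra.Quotient.mkBialgHom (R := k) (kerI k B)) ∧
      LinearMap.range (iMap k B) = ⊤ ∧
      ∃ e : Oslash k B ≃ₗc[k] (B ⧸ kerI k B),
        (∀ x y : B, e (Oslash.mk k x y) =
          Bialgebra.Quotient.mkBialgHom (R := k) (kerI k B) x *
            S (Bialgebra.Quotient.mkBialgHom (R := k) (kerI k B) y)) ∧
        ∀ b : B, e.symm (Bialgebra.Quotient.mkBialgHom (R := k) (kerI k B) b) = iMap k B b := by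
  have hB' : IsRightPerfectRing B :=
    hB.elim (fun _ => isRightPerfectRing_of_finiteDimensional k B) id
  have h₁ : (kerI k B).IsTwoSided := ⟨fun b hκ => mul_mem_kerI hB' hκ b⟩
  have h₂ : ((kerI k B).restrictScalars k).IsCoideal := isCoideal_kerI k B
  obtain ⟨S, hS, hSmk⟩ := exists_isAntipode (k := k) hB'
  refine ⟨h₁, h₂, S, hS, ⟨⟨S, hS⟩, fun L _ _ f => existsUnique_comp_mkBialgHom f⟩, range_iMap hB',
    (iMapEquiv k hB').symm, fun x y => ?_, fun b => ?_⟩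
  · rw [← (iMapEquiv k hB').symm_apply_apply (_ * _)]
    congr 1
    obtain ⟨a, ha⟩ := exists_mk_one_eq_mk (k := k) hB' y
    have h3 : S (Bialgebra.Quotient.mkBialgHom (R := k) (kerI k B) y) =
        Bialgebra.Quotient.mkBialgHom (R := k) (kerI k B) a := by
      apply iMapEquiv_injective hB'
      rw [hSmk, ha, iMapEquiv_mk]
    have h4 := Oslash.mk_mul_left ha x
    rw [mul_one] at h4
    rw [h3, ← map_mul, iMapEquiv_mk, h4]
  · rfl
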